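/- Let $n,m\ge 1$, $\nu=\min\{n,m\}$, and equip $\mathbb{R}^{n\times m}$ with the Frobenius inner product $\langle A,B\rangle=\operatorname{tr}(A^TB)$ and Frobenius norm $\|\cdot\|_F$. For $S\in\mathbb{R}^{n\times m}$ let $\|S\|_2$ be the operator norm induced by the Euclidean norms, let $\sigma_{\max}(S)=\sigma_1(S)\ge\dots\ge\sigma_\nu(S)\ge 0$ be the singular values, and put $$r(S)=\tfrac12\|S\|_2^2-\tfrac1{2\nu}\|S\|_F^2 .$$ A singular value decomposition (SVD) of $S$ is a pair of orthogonal matrices $U\in\mathbb{R}^{n\times n}$, $V\in\mathbb{R}^{m\times m}$ with $S=U\,\mathrm{Diag}(\sigma(S))\,V^T$, where $\mathrm{Diag}(\sigma(S))\in\mathbb{R}^{n\times m}$ is rectangular diagonal; $u_i,v_i$ denote the $i$-th columns of $U,V$. For $f:\mathbb{R}^{n\times m}\to\mathbb{R}$, the Fréchet subdifferential $\hat\partial f(X)$ is the set of $G$ with $\liminf_{Y\to X}\frac{f(Y)-f(X)-\langle G,Y-X\rangle}{\|Y-X\|_F}\ge 0$, and the limiting (Mordukhovich) subdifferential $\partial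 f(X)$ is the set of all limits of sequences $G_k\in\hat\partial f(X_k)$ with $X_k\to X$ and $f(X_k)\to f(X)$. Let $S\in\mathbb{R}^{n\times m}$. (1) If $\sigma_1(S)>\sigma_i(S)$ for all $1<i\le\nu$, then $r$ is differentiable at $S$ and, for every SVD $(U,V)$ of $S$, $$\nabla r(S)=\sigma_{\max}(S)\,u_1v_1^T-\tfrac1\nu S .$$ (2) Otherwise, $$\partial r(S)=\bigcup_{(U,V)\ \text{SVD of}\ S}\operatorname{conv}\{\sigma_i(S)\,u_iv_i^T : 1\le i\le\nu,\ \sigma_i(S)=\sigma_{\max}(S)\}-\tfrac1\nu S ,$$ and this set also equals $$\operatorname{conv}\{\sigma_{\max}(S)\,uv^T : \|u\|=\|v\|=1,\ Sv=\sigma_{\max}(S)u,\ S^Tu=\sigma_{\max}(S)v\}-\tfrac1\nu S .$$ -/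

import Mathlib

open Filter Topology

attribute [local instance] Matrix.frobeniusNormedAddCommGroup Matrix.frobeniusNormedSpace

noncomputable section

namespace MatReg

/-- The Frobenius (trace) inner product `⟪A, B⟫ = ∑ i j, A i j * B i j` on real matrices. Its norm is
the Frobenius norm. -/
instance frobeniusInner (n m : ℕ) : InnerProductSpace ℝ (Matrix (Fin n) (Fin m) ℝ) where
  toNormedSpace := Matrix.frobeniusNormedSpace
  inner A B := ∑ i, ∑ j, A i j * B i j
  norm_sq_eq_re_inner A := by
    have h0 : 0 ≤ ∑ i, ∑ j, ‖A i j‖ ^ (2 : ℝ) := by positivity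
    rw [Matrix.frobenius_norm_def, ← Real.sqrt_eq_rpow, Real.sq_sqrt h0]
    simp [sq]
  conj_inner_symm A B := by simp [mul_comm]
  add_left A B C := by simp [add_mul, Finset.sum_add_distrib]
  smul_left A B c := by simp [Finset.mul_sum, mul_assoc]

section Subdifferential

variable {E : Type*} [NormedAddCommGroup E] [InnerProductSpace ℝ E]

/-- The Fréchet (regular) subdifferential of a real-valued function. The lower limit is taken in the
extended reals, over `y → x` with `y ≠ x`. -/
def frechetSubdifferential (f : E → ℝ) (x : E) : Set E :=
  {v | (0 : EReal) ≤
    liminf (fun y : E => (((f y - f x - inner ℝ v (y - x)) / ‖y - x‖ : ℝ) : EReal)) (𝓝[≠] x)}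

/-- The Mordukhovich (limiting) subdifferential of a real-valued function. -/
def limitingSubdifferential (f : E → ℝ) (x : E) : Set E :=
  {v | ∃ (xs : ℕ → E) (vs : ℕ → E), Tendsto xs atTop (𝓝 x) ∧ Tendsto vs atTop (𝓝 v) ∧
    (∀ k, vs k ∈ frechetSubdifferential f (xs k)) ∧
    Tendsto (fun k => f (xs k)) atTop (𝓝 (f x))}

end Subdifferential

variable {n m : ℕ}

/-- The spectral norm: the operator norm with respect to the Euclidean norms. -/
def opNorm (S : Matrix (Fin n) (Fin m) ℝ) : ℝ :=
  ‖LinearMap.toContinuousLinearMap (Matrix.toEuclideanLin S)‖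

/-- The regularizer `r(S) = ½ ‖S‖₂² - 1/(2ν) ‖S‖_F²` with `ν = min n m`
(here `‖S‖` is the Frobenius norm). -/
def reg (S : Matrix (Fin n) (Fin m) ℝ) : ℝ :=
  1 / 2 * opNorm S ^ 2 - 1 / (2 * ((min n m : ℕ) : ℝ)) * ‖S‖ ^ 2

/-- The singular values of `S` in decreasing order, indexed from `0`. -/
def sv (S : Matrix (Fin n) (Fin m) ℝ) (i : ℕ) : ℝ :=
  (Matrix.toEuclideanLin S).singularValues i

/-- The largest singular value. -/
def svMax (S : Matrix (Fin n) (Fin m) ℝ) : ℝ := sv S 0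

/-- The rectangular diagonal matrix of the singular values of `S`. -/
def diagSv (S : Matrix (Fin n) (Fin m) ℝ) : Matrix (Fin n) (Fin m) ℝ :=
  Matrix.of fun i j => if (i : ℕ) = (j : ℕ) then sv S i else 0

/-- `S = U Diag(σ(S)) Vᵀ` is a (full) singular value decomposition of `S`. -/
structure IsSVD (S : Matrix (Fin n) (Fin m) ℝ) (U : Matrix (Fin n) (Fin n) ℝ)
    (V : Matrix (Fin m) (Fin m) ℝ) : Prop where
  left_orthogonal : U ∈ Matrix.orthogonalGroup (Fin n) ℝ
  right_orthogonal : V ∈ Matrix.orthogonalGroup (Fin m) ℝ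
  decomp : S = U * diagSv S * V.transpose

/-- The rank-one matrix `uᵢ vᵢᵀ` built from the `i`-th columns of `U` and `V`. -/
def outerCol (U : Matrix (Fin n) (Fin n) ℝ) (V : Matrix (Fin m) (Fin m) ℝ)
    (i : Fin (min n m)) : Matrix (Fin n) (Fin m) ℝ :=
  Matrix.vecMulVec (U.col (Fin.castLE (Nat.min_le_left n m) i))
    (V.col (Fin.castLE (Nat.min_le_right n m) i))

/-- The largest singular value of `S` is simple: `σ₁(S) > σᵢ(S)` for all `1 < i ≤ ν`. -/
def SimpleTop (S : Matrix (Fin n) (Fin m) ℝ) : Prop :=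
  ∀ i : ℕ, 0 < i → i < min n m → sv S i < sv S 0

/-- `conv {σᵢ(S) uᵢ vᵢᵀ | σᵢ(S) = σ_max(S)}` for the columns of given `U` and `V`. -/
def topHull (S : Matrix (Fin n) (Fin m) ℝ) (U : Matrix (Fin n) (Fin n) ℝ)
    (V : Matrix (Fin m) (Fin m) ℝ) : Set (Matrix (Fin n) (Fin m) ℝ) :=
  convexHull ℝ {G | ∃ i : Fin (min n m), sv S i = svMax S ∧ G = sv S i • outerCol U V i}

/-- `(u, v)` is a pair of unit singular vectors of `S` for the largest singular value. -/
structure IsTopPair (S : Matrix (Fin n) (Fin m) ℝ) (u : Fin n → ℝ) (v : Fin m → ℝ) : Prop where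
  left_unit : u ⬝ᵥ u = 1
  right_unit : v ⬝ᵥ v = 1
  mulVec_right : S.mulVec v = svMax S • u
  mulVec_left : S.transpose.mulVec u = svMax S • v

end MatReg

end

/-!
Write `f S = ½ ‖S‖₂²`, a convex function, so that `reg = f - c ‖·‖²` with `c = 1 / (2ν)`. For such a
difference a Fréchet subgradient at `S` is exactly a global convex subgradient of `f` minus
`2c S`, and convex subgradient inequalities pass to limits, so the limiting subdifferential of `reg`
is the convex subdifferential of `f` shifted by `-S / ν`
(`mem_limitingSubdifferential_sub_norm_sq_iff`).

The convex subdifferential of `f` at `S` is the convex hull of the matrices `(S v) vᵀ`, where `v`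
runs over the unit vectors at which the operator norm is attained
(`mem_convexHull_extremeGradients_iff`). Each of them is a subgradient since
`½ ‖Y v‖² ≥ ½ ‖S v‖² + ⟪S v, (Y - S) v⟫`. Conversely, a subgradient outside the hull could be
strictly separated from it in some direction `D`, which contradicts Danskin's principle
(`exists_maxVector_half_norm_sq_add_le`): to first order `f (S + D) - f S` is at most
`⟪S v, D v⟫` for some maximal `v`. The same two bounds give differentiability when there is only one
matrix `(S v) vᵀ`, as is the case for a simple largest singular value. For `S ≠ 0` the maximal `v`
are the right members of the top singular pairs, and `S v = σ_max u`; for `S = 0` everything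
collapses to `0`. This is the description of the subdifferential by top pairs.

It remains to see that a convex combination `A = ∑ cₖ (S vₖ) vₖᵀ` belongs to the hull of a single
SVD (`exists_isSVD_mem_topHull`). The symmetric operator `M = ∑ cₖ vₖ vₖᵀ` acts on the eigenspace of
`SᵀS` for `σ_max²`, and has nonnegative eigenvalues that sum to `1`. An orthonormal eigenbasis `bᵢ`
of `M`, with eigenvalues `μᵢ`, is completed to the right factor of an SVD, and then
`A = S M = ∑ μᵢ (S bᵢ) bᵢᵀ`.
-/

namespace MatReg

/-! ### Subdifferentials of a convex function minus a multiple of the squared norm -/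

section Convex

variable {E : Type*} [NormedAddCommGroup E] [InnerProductSpace ℝ E]

/-- The `ε`-form of the Fréchet subdifferential. Clearing the denominator makes the inequality
trivial at `y = x`, so the punctured neighborhood can be replaced by the full one. -/
theorem mem_frechetSubdifferential_iff {f : E → ℝ} {x v : E} :
    v ∈ frechetSubdifferential f x ↔
      ∀ ε > 0, ∀ᶠ y in 𝓝 x, -(ε * ‖y - x‖) ≤ f y - f x - inner ℝ v (y - x) := by
  have key (ε : ℝ) : (∀ᶠ y in 𝓝 x, -(ε * ‖y - x‖) ≤ f y - f x - inner ℝ v (y - x)) ↔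
      ∀ᶠ y in 𝓝[≠] x, -ε ≤ (f y - f x - inner ℝ v (y - x)) / ‖y - x‖ := by
    rw [eventually_nhdsWithin_iff]
    refine eventually_congr (Eventually.of_forall fun y => ?_)
    by_cases hy : y = x
    · simp [hy]
    · have : 0 < ‖y - x‖ := norm_pos_iff.2 (sub_ne_zero.2 hy)
      simp [hy, le_div_iff₀ this]
  simp only [key, frechetSubdifferential, Set.mem_ofPred_eq]
  rw [le_liminf_iff']
  constructor
  · intro h ε hε
    refine (h ((-ε : ℝ) : EReal) (by exact_mod_cast neg_lt_zero.2 hε)).mono fun y hy => ?_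
    exact_mod_cast hy
  · intro h a ha
    obtain ⟨b, hab, hb⟩ := EReal.lt_iff_exists_real_btwn.1 ha
    have hb' : b < 0 := by exact_mod_cast hb
    refine (h (-b) (by linarith)).mono fun y hy => hab.le.trans ?_
    rw [neg_neg] at hy
    exact_mod_cast hy

/-- For convex `f`, a Fréchet subgradient of `f - c ‖·‖²` differs from a global convex subgradient
of `f` by the gradient of `c ‖·‖²`. -/
theorem mem_frechetSubdifferential_sub_norm_sq_iff {f : E → ℝ} (hf : ConvexOn ℝ Set.univ f)
    {c : ℝ} (hc : 0 ≤ c) {x v : E} :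
    v ∈ frechetSubdifferential (fun y => f y - c * ‖y‖ ^ 2) x ↔
      ∀ y, f x + inner ℝ (v + (2 * c) • x) (y - x) ≤ f y := by
  have expand (y : E) : ‖y‖ ^ 2 = ‖x‖ ^ 2 + 2 * inner ℝ x (y - x) + ‖y - x‖ ^ 2 := by
    rw [← norm_add_sq_real]; simp
  rw [mem_frechetSubdifferential_iff]
  constructor
  · intro h y
    refine le_of_forall_pos_le_add fun ε hε => ?_
    set D := y - x with hD
    have hδ : 0 < ε / (‖D‖ + 1) := by positivity
    have hcont : Tendsto (fun t : ℝ => x + t • D) (𝓝[>] 0) (𝓝 x) := by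
      have : Continuous fun t : ℝ => x + t • D := by fun_prop
      simpa using (this.tendsto 0).mono_left nhdsWithin_le_nhds
    have h1 := hcont.eventually (h _ hδ)
    have h2 : ∀ᶠ t : ℝ in 𝓝[>] 0, t < 1 :=
      nhdsWithin_le_nhds (Iio_mem_nhds zero_lt_one)
    obtain ⟨t, ht, ht1, ht0⟩ := (h1.and (h2.and self_mem_nhdsWithin)).exists
    have ht0 : 0 < t := ht0
    have hcx := hf.2 (Set.mem_univ x) (Set.mem_univ y) (sub_nonneg.2 ht1.le) ht0.le (by ring)
    have hxy : (1 - t) • x + t • y = x + t • D := by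
      rw [hD, smul_sub, sub_smul, one_smul]; abel
    rw [hxy] at hcx
    simp only [smul_eq_mul] at hcx
    have e := expand (x + t • D)
    rw [add_sub_cancel_left] at ht e
    rw [e] at ht
    rw [norm_smul, Real.norm_of_nonneg ht0.le, real_inner_smul_right, real_inner_smul_right] at ht
    have h3 : ε / (‖D‖ + 1) * (t * ‖D‖) ≤ t * ε := by
      rw [div_mul_eq_mul_div, div_le_iff₀ (by positivity)]
      nlinarith [mul_pos ht0 hε]
    rw [inner_add_left, real_inner_smul_left]
    have h4 : 0 ≤ c * (t * ‖D‖) ^ 2 := by positivity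
    have h5 : t * (f x + (inner ℝ v D + 2 * c * inner ℝ x D)) ≤ t * (f y + ε) := by
      linarith
    exact le_of_mul_le_mul_left h5 ht0
  · intro h ε hε
    have hc' : Tendsto (fun y : E => c * ‖y - x‖) (𝓝 x) (𝓝 0) := by
      have : Continuous fun y : E => c * ‖y - x‖ := by fun_prop
      simpa using this.tendsto x
    filter_upwards [hc'.eventually (Iio_mem_nhds hε)] with y hy
    have hy : c * ‖y - x‖ < ε := hy
    have := h y
    rw [inner_add_left, real_inner_smul_left] at this
    rw [expand y]
    nlinarith [mul_le_mul_of_nonneg_right hy.le (norm_nonneg (y - x))]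

/-- Convex subgradient inequalities survive limits, so the limiting subdifferential of
`f - c ‖·‖²` is no larger than the Fréchet subdifferential. -/
theorem mem_limitingSubdifferential_sub_norm_sq_iff {f : E → ℝ} (hf : ConvexOn ℝ Set.univ f)
    (hcont : Continuous f) {c : ℝ} (hc : 0 ≤ c) {x v : E} :
    v ∈ limitingSubdifferential (fun y => f y - c * ‖y‖ ^ 2) x ↔
      ∀ y, f x + inner ℝ (v + (2 * c) • x) (y - x) ≤ f y := by
  constructor
  · rintro ⟨xs, vs, hxs, hvs, hmem, -⟩ y
    refine le_of_tendsto (f := fun k => f (xs k) + inner ℝ (vs k + (2 * c) • xs k) (y - xs k))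
      (x := atTop) ?_ (Eventually.of_forall fun k =>
        (mem_frechetSubdifferential_sub_norm_sq_iff hf hc).1 (hmem k) y)
    exact ((hcont.tendsto x).comp hxs).add
      ((hvs.add (hxs.const_smul _)).inner (tendsto_const_nhds.sub hxs))
  · intro h
    exact ⟨fun _ => x, fun _ => v, tendsto_const_nhds, tendsto_const_nhds,
      fun _ => (mem_frechetSubdifferential_sub_norm_sq_iff hf hc).2 h, tendsto_const_nhds⟩

/-! ### Compactness of convex hulls in finite dimension -/

/-- In finite dimension the convex hull of a compact set is compact: by Carathéodory's theorem it is
the image of a compact set of convex combinations of bounded length. -/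
theorem isCompact_convexHull_of_finiteDimensional {E : Type*} [NormedAddCommGroup E]
    [NormedSpace ℝ E] [FiniteDimensional ℝ E] {s : Set E} (hs : IsCompact s) :
    IsCompact (convexHull ℝ s) := by
  obtain rfl | ⟨a, ha⟩ := s.eq_empty_or_nonempty
  · simp
  set N := Module.finrank ℝ E + 1
  have himage : convexHull ℝ s =
      (fun p : (Fin N → E) × (Fin N → ℝ) => ∑ i, p.2 i • p.1 i) ''
        ((Set.univ.pi fun _ => s) ×ˢ stdSimplex ℝ (Fin N)) := by
    refine Set.Subset.antisymm (fun x hx => ?_) ?_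
    · obtain ⟨ι, _, z, w, hz, hind, hw, hw1, hx⟩ := eq_pos_convex_span_of_mem_convexHull hx
      have hcard : Fintype.card ι ≤ Fintype.card (Fin N) := by
        rw [Fintype.card_fin]
        exact hind.card_le_finrank_succ.trans
          (Nat.add_le_add_right (Submodule.finrank_le _) 1)
      obtain ⟨e⟩ := Function.Embedding.nonempty_of_card_le hcard
      have hsupp : ∀ i, i ∉ Set.range e → Function.extend e w 0 i = 0 := fun i hi =>
        Function.extend_apply' _ _ _ (by simpa using hi)
      refine ⟨(Function.extend e z fun _ => a, Function.extend e w 0),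
        ⟨fun i _ => ?_, fun i => ?_, ?_⟩, ?_⟩
      · show Function.extend e z (fun _ => a) i ∈ s
        by_cases hi : ∃ j, e j = i
        · obtain ⟨j, rfl⟩ := hi
          rw [e.injective.extend_apply]
          exact hz ⟨j, rfl⟩
        · rwa [Function.extend_apply' _ _ _ hi]
      · by_cases hi : ∃ j, e j = i
        · obtain ⟨j, rfl⟩ := hi
          simpa [e.injective.extend_apply] using (hw j).le
        · simp [Function.extend_apply' _ _ _ hi]
      · rw [← hw1]
        exact (Fintype.sum_of_injective e e.injective _ _ hsupp
          fun j => (e.injective.extend_apply _ _ _).symm).symm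
      · rw [← hx]
        refine (Fintype.sum_of_injective e e.injective _ _ (fun i hi => ?_) fun j => ?_).symm
        · simp [hsupp i hi]
        · simp [e.injective.extend_apply]
    · rintro _ ⟨⟨z, w⟩, ⟨hz, hw⟩, rfl⟩
      exact (convex_convexHull ℝ s).sum_mem (fun i _ => hw.1 i) hw.2
        fun i _ => subset_convexHull ℝ s (hz i trivial)
  rw [himage]
  exact ((isCompact_univ_pi fun _ => hs).prod (isCompact_stdSimplex ℝ _)).image (by fun_prop)

end Convex

/-! ### First-order bounds for the squared operator norm -/

section OperatorNorm

variable {E F : Type*} [NormedAddCommGroup E] [InnerProductSpace ℝ E] [FiniteDimensional ℝ E]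
  [NormedAddCommGroup F] [InnerProductSpace ℝ F]

/-- Unit vectors at which the operator norm of `T` is attained, i.e. the unit right singular
vectors for the largest singular value. -/
def maxVectors (T : E →L[ℝ] F) : Set E := {v | ‖v‖ = 1 ∧ ‖T v‖ = ‖T‖}

theorem isCompact_maxVectors (T : E →L[ℝ] F) : IsCompact (maxVectors T) := by
  have : maxVectors T = Metric.sphere 0 1 ∩ {v | ‖T v‖ = ‖T‖} := by
    ext v; simp [maxVectors]
  rw [this]
  exact (isCompact_sphere 0 1).inter_right (isClosed_eq (by fun_prop) continuous_const)

theorem maxVectors_nonempty [Nontrivial E] (T : E →L[ℝ] F) : (maxVectors T).Nonempty := by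
  obtain ⟨v, hv, hmax⟩ := (isCompact_sphere (0 : E) 1).exists_isMaxOn
    (NormedSpace.sphere_nonempty.2 zero_le_one) (f := fun v => ‖T v‖) (by fun_prop)
  have hv1 : ‖v‖ = 1 := by simpa using hv
  refine ⟨v, hv1, le_antisymm (by simpa [hv1] using T.le_opNorm v) ?_⟩
  refine T.opNorm_le_of_unit_norm (norm_nonneg _) fun x hx => ?_
  exact hmax (show x ∈ Metric.sphere 0 1 by simpa using hx)

theorem adjoint_apply_apply_of_mem_maxVectors [FiniteDimensional ℝ F] {T : E →L[ℝ] F}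
    {v : E} (hv : v ∈ maxVectors T) :
    T.adjoint (T v) = ‖T‖ ^ 2 • v := by
  obtain ⟨hv1, hv2⟩ := hv
  have h1 : ‖T.adjoint (T v)‖ ≤ ‖T‖ ^ 2 := by
    refine (T.adjoint.le_opNorm _).trans ?_
    rw [hv2, LinearIsometryEquiv.norm_map, sq]
  have h2 : inner ℝ (T.adjoint (T v)) (‖T‖ ^ 2 • v) = ‖T‖ ^ 4 := by
    rw [real_inner_smul_right, ContinuousLinearMap.adjoint_inner_left,
      real_inner_self_eq_norm_sq, hv2]
    ring
  have h3 := norm_sub_sq_real (T.adjoint (T v)) (‖T‖ ^ 2 • v)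
  rw [h2, norm_smul, hv1, Real.norm_of_nonneg (by positivity)] at h3
  have h4 : ‖T.adjoint (T v)‖ ^ 2 ≤ (‖T‖ ^ 2) ^ 2 := by gcongr
  have h5 : ‖T.adjoint (T v) - ‖T‖ ^ 2 • v‖ ^ 2 ≤ 0 := by rw [h3]; linarith
  have h6 : ‖T.adjoint (T v) - ‖T‖ ^ 2 • v‖ = 0 := by
    exact pow_eq_zero_iff two_ne_zero |>.1 (le_antisymm h5 (by positivity))
  exact sub_eq_zero.1 (norm_eq_zero.1 h6)

/-- Danskin's principle for `½ ‖T‖²`, uniform in the direction: to first order the increment is at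
most `⟪T v, D v⟫` for some maximal vector `v` of the unperturbed `T`. Otherwise there are
`D k → 0` violating the bound, and the maximal vectors of `T + D k` accumulate at a maximal vector
of `T` for which it holds. -/
theorem exists_maxVector_half_norm_sq_add_le [Nontrivial E] (T : E →L[ℝ] F) {ε : ℝ} (hε : 0 < ε) :
    ∃ δ > 0, ∀ D : E →L[ℝ] F, ‖D‖ < δ → ∃ v ∈ maxVectors T,
      1 / 2 * ‖T + D‖ ^ 2 - 1 / 2 * ‖T‖ ^ 2 ≤ inner ℝ (T v) (D v) + ε * ‖D‖ := by
  by_contra! h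
  choose D hDlt hD using fun k : ℕ => h (1 / ((k : ℝ) + 1)) (by positivity)
  have hD0 : Tendsto (fun k => ‖D k‖) atTop (𝓝 0) :=
    squeeze_zero (fun _ => norm_nonneg _) (fun k => (hDlt k).le)
      tendsto_one_div_add_atTop_nhds_zero_nat
  have hD0' : Tendsto D atTop (𝓝 0) := tendsto_zero_iff_norm_tendsto_zero.2 hD0
  choose w hw using fun k => maxVectors_nonempty (T + D k)
  obtain ⟨v, hv, φ, hφ, hlim⟩ := (isCompact_sphere (0 : E) 1).tendsto_subseq
    (x := w) (fun k => by simpa using (hw k).1)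
  have hv1 : ‖v‖ = 1 := by simpa using hv
  have hTD : Tendsto (fun k => T + D (φ k)) atTop (𝓝 T) := by
    simpa using tendsto_const_nhds.add (hD0'.comp hφ.tendsto_atTop)
  have hvT : ‖T v‖ = ‖T‖ := by
    have h1 : Tendsto (fun k => ‖(T + D (φ k)) (w (φ k))‖) atTop (𝓝 ‖T v‖) :=
      (((isBoundedBilinearMap_apply (𝕜 := ℝ) (E := E) (F := F)).continuous.tendsto
        (T, v)).comp (hTD.prodMk_nhds hlim)).norm
    refine tendsto_nhds_unique h1 (hTD.norm.congr fun k => ?_)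
    exact ((hw (φ k)).2).symm
  -- the defect of the bound at `v` is `o(‖D k‖)`
  have hsmall : Tendsto (fun k => 2 * ‖T‖ * ‖w (φ k) - v‖ + 1 / 2 * ‖D (φ k)‖) atTop (𝓝 0) := by
    have h1 : Tendsto (fun k => ‖w (φ k) - v‖) atTop (𝓝 0) :=
      tendsto_iff_norm_sub_tendsto_zero.1 hlim
    have h2 := (h1.const_mul (2 * ‖T‖)).add ((hD0.comp hφ.tendsto_atTop).const_mul (1 / 2))
    rwa [mul_zero, mul_zero, add_zero] at h2
  obtain ⟨k, hk⟩ := (hsmall.eventually (Iio_mem_nhds hε)).exists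
  have hk : 2 * ‖T‖ * ‖w (φ k) - v‖ + 1 / 2 * ‖D (φ k)‖ < ε := hk
  have hbad := hD (φ k) v ⟨hv1, hvT⟩
  obtain ⟨hu1, hu2⟩ := hw (φ k)
  set u := w (φ k)
  set A := D (φ k)
  have e1 : ‖T + A‖ ^ 2 = ‖T u‖ ^ 2 + 2 * inner ℝ (T u) (A u) + ‖A u‖ ^ 2 := by
    rw [← hu2, add_apply, norm_add_sq_real]
  have e2 : ‖T u‖ ≤ ‖T‖ := by simpa [hu1] using T.le_opNorm u
  have e3 : ‖A u‖ ≤ ‖A‖ := by simpa [hu1] using A.le_opNorm u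
  have e4 : inner ℝ (T u) (A u) - inner ℝ (T v) (A v) ≤ 2 * ‖T‖ * ‖u - v‖ * ‖A‖ := by
    have : inner ℝ (T u) (A u) - inner ℝ (T v) (A v)
        = inner ℝ (T (u - v)) (A u) + inner ℝ (T v) (A (u - v)) := by
      simp only [map_sub, inner_sub_left, inner_sub_right]; ring
    rw [this]
    have i1 : inner ℝ (T (u - v)) (A u) ≤ (‖T‖ * ‖u - v‖) * ‖A‖ :=
      (real_inner_le_norm _ _).trans
        (mul_le_mul (T.le_opNorm _) e3 (norm_nonneg _) (by positivity))
    have i2 : inner ℝ (T v) (A (u - v)) ≤ ‖T‖ * (‖A‖ * ‖u - v‖) :=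
      (real_inner_le_norm _ _).trans
        (mul_le_mul hvT.le (A.le_opNorm _) (norm_nonneg _) (by positivity))
    linarith
  have e5 : ‖T u‖ ^ 2 ≤ ‖T‖ ^ 2 := by gcongr
  have e6 : ‖A u‖ ^ 2 ≤ ‖A‖ ^ 2 := by gcongr
  have e7 := mul_le_mul_of_nonneg_right hk.le (norm_nonneg A)
  nlinarith

end OperatorNorm

end MatReg

namespace MatReg

/-! ### Matrices as operators and rank-one matrices -/

variable {n m : ℕ}

/-- The continuous linear map between Euclidean spaces given by a matrix, linearly in the matrix.
Its norm is `opNorm`. -/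
noncomputable def euclideanCLM :
    Matrix (Fin n) (Fin m) ℝ →ₗ[ℝ] EuclideanSpace ℝ (Fin m) →L[ℝ] EuclideanSpace ℝ (Fin n) :=
  (Matrix.toEuclideanLin.trans LinearMap.toContinuousLinearMap).toLinearMap

/-- The rank-one matrix `x yᵀ` of two Euclidean vectors. -/
def outer (x : EuclideanSpace ℝ (Fin n)) (y : EuclideanSpace ℝ (Fin m)) :
    Matrix (Fin n) (Fin m) ℝ :=
  Matrix.vecMulVec x.ofLp y.ofLp

theorem opNorm_eq (S : Matrix (Fin n) (Fin m) ℝ) : opNorm S = ‖euclideanCLM S‖ := rfl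

theorem euclideanCLM_apply (S : Matrix (Fin n) (Fin m) ℝ) (x : EuclideanSpace ℝ (Fin m)) :
    euclideanCLM S x = WithLp.toLp 2 (S.mulVec x.ofLp) := rfl

theorem adjoint_euclideanCLM (S : Matrix (Fin n) (Fin m) ℝ) :
    (euclideanCLM S).adjoint = euclideanCLM S.transpose := by
  have h := Matrix.toEuclideanLin_conjTranspose_eq_adjoint S
  rw [Matrix.conjTranspose_eq_transpose_of_trivial] at h
  ext1 x
  exact (congrArg (fun L => L x) h).symm

theorem inner_outer_left (x : EuclideanSpace ℝ (Fin n)) (y : EuclideanSpace ℝ (Fin m))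
    (D : Matrix (Fin n) (Fin m) ℝ) :
    inner ℝ (outer x y) D = inner ℝ x (euclideanCLM D y) := by
  change ∑ i, ∑ j, outer x y i j * D i j = _
  simp only [outer, Matrix.vecMulVec_apply, euclideanCLM_apply, PiLp.inner_apply, Matrix.mulVec,
    dotProduct, RCLike.inner_apply, conj_trivial, Finset.sum_mul]
  exact Finset.sum_congr rfl fun i _ => Finset.sum_congr rfl fun j _ => by ring

theorem outer_apply (x : EuclideanSpace ℝ (Fin n)) (y z : EuclideanSpace ℝ (Fin m)) :
    euclideanCLM (outer x y) z = inner ℝ y z • x := by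
  ext i
  simp [euclideanCLM_apply, outer, Matrix.mulVec, dotProduct, Matrix.vecMulVec_apply,
    PiLp.inner_apply, Finset.sum_mul]
  exact Finset.sum_congr rfl fun j _ => by ring

theorem norm_outer (x : EuclideanSpace ℝ (Fin n)) (y : EuclideanSpace ℝ (Fin m)) :
    ‖outer x y‖ = ‖x‖ * ‖y‖ := by
  have h : ‖outer x y‖ ^ 2 = (‖x‖ * ‖y‖) ^ 2 := by
    rw [← real_inner_self_eq_norm_sq, inner_outer_left, outer_apply, real_inner_smul_right,
      real_inner_self_eq_norm_sq, real_inner_self_eq_norm_sq]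
    ring
  exact (pow_left_inj₀ (norm_nonneg _) (by positivity) two_ne_zero).1 h

/-- The spectral norm is at most the Frobenius norm. -/
theorem norm_euclideanCLM_le (D : Matrix (Fin n) (Fin m) ℝ) : ‖euclideanCLM D‖ ≤ ‖D‖ := by
  refine (euclideanCLM D).opNorm_le_bound (norm_nonneg _) fun x => ?_
  have h : ‖euclideanCLM D x‖ * ‖euclideanCLM D x‖ ≤ ‖euclideanCLM D x‖ * (‖D‖ * ‖x‖) := by
    rw [← real_inner_self_eq_norm_mul_norm, ← inner_outer_left]
    refine (real_inner_le_norm _ _).trans_eq ?_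
    rw [norm_outer]
    ring
  rcases (norm_nonneg (euclideanCLM D x)).eq_or_lt with h0 | h0
  · rw [← h0]; positivity
  · exact le_of_mul_le_mul_left h h0

theorem continuous_opNorm : Continuous (opNorm : Matrix (Fin n) (Fin m) ℝ → ℝ) := by
  have : Continuous (euclideanCLM (n := n) (m := m)) := LinearMap.continuous_of_finiteDimensional _
  exact this.norm

theorem convexOn_half_opNorm_sq :
    ConvexOn ℝ Set.univ fun S : Matrix (Fin n) (Fin m) ℝ => 1 / 2 * opNorm S ^ 2 := by
  have h : ConvexOn ℝ Set.univ (opNorm : Matrix (Fin n) (Fin m) ℝ → ℝ) := by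
    exact (convexOn_univ_norm (E := EuclideanSpace ℝ (Fin m) →L[ℝ]
      EuclideanSpace ℝ (Fin n))).comp_linearMap euclideanCLM
  exact (h.pow (fun S _ => norm_nonneg _) 2).smul (by norm_num)

/-! ### The convex subdifferential of half the squared spectral norm -/

/-- The matrices `(S v) vᵀ` with `v` a unit top right singular vector of `S`. When `S ≠ 0` these
are the matrices `σ_max u vᵀ` with `(u, v)` a top pair. -/
def extremeGradients (S : Matrix (Fin n) (Fin m) ℝ) : Set (Matrix (Fin n) (Fin m) ℝ) :=
  (fun v => outer (euclideanCLM S v) v) '' maxVectors (euclideanCLM S)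

theorem isCompact_extremeGradients (S : Matrix (Fin n) (Fin m) ℝ) :
    IsCompact (extremeGradients S) := by
  refine (isCompact_maxVectors _).image ?_
  unfold outer Matrix.vecMulVec
  fun_prop

/-- A maximal vector `v` gives the affine minorant `½ ‖S v‖² + ⟪S v, (Y - S) v⟫` of `½ ‖Y v‖²`,
hence of `½ ‖Y‖²`, and it is exact at `S`. -/
theorem half_opNorm_sq_add_inner_le_of_mem_extremeGradients {S H : Matrix (Fin n) (Fin m) ℝ}
    (hH : H ∈ extremeGradients S) (Y : Matrix (Fin n) (Fin m) ℝ) :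
    1 / 2 * opNorm S ^ 2 + inner ℝ H (Y - S) ≤ 1 / 2 * opNorm Y ^ 2 := by
  obtain ⟨v, ⟨hv1, hv2⟩, rfl⟩ := hH
  rw [inner_outer_left, opNorm_eq, opNorm_eq, ← hv2, map_sub, sub_apply, inner_sub_right,
    real_inner_self_eq_norm_sq]
  have h1 : ‖euclideanCLM Y v‖ ≤ ‖euclideanCLM Y‖ := by
    simpa [hv1] using (euclideanCLM Y).le_opNorm v
  have h2 : ‖euclideanCLM Y v‖ ^ 2 ≤ ‖euclideanCLM Y‖ ^ 2 := by gcongr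
  have h3 := norm_sub_sq_real (euclideanCLM S v) (euclideanCLM Y v)
  have h4 := sq_nonneg ‖euclideanCLM S v - euclideanCLM Y v‖
  linarith

theorem half_opNorm_sq_add_inner_le_of_mem_convexHull {S H : Matrix (Fin n) (Fin m) ℝ}
    (hH : H ∈ convexHull ℝ (extremeGradients S)) (Y : Matrix (Fin n) (Fin m) ℝ) :
    1 / 2 * opNorm S ^ 2 + inner ℝ H (Y - S) ≤ 1 / 2 * opNorm Y ^ 2 := by
  have hconv : Convex ℝ {H : Matrix (Fin n) (Fin m) ℝ |
      inner ℝ H (Y - S) ≤ 1 / 2 * opNorm Y ^ 2 - 1 / 2 * opNorm S ^ 2} :=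
    convex_halfSpace_le (f := fun H : Matrix (Fin n) (Fin m) ℝ => inner ℝ H (Y - S))
      ⟨fun _ _ => inner_add_left _ _ _, fun _ _ => real_inner_smul_left _ _ _⟩ _
  have := convexHull_min (fun H hH => by
    have := half_opNorm_sq_add_inner_le_of_mem_extremeGradients hH Y
    show inner ℝ H (Y - S) ≤ _
    linarith) hconv hH
  have : inner ℝ H (Y - S) ≤ 1 / 2 * opNorm Y ^ 2 - 1 / 2 * opNorm S ^ 2 := this
  linarith

/-- The convex subdifferential of `½ ‖·‖₂²`. A subgradient outside the (compact) hull would be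
strictly separated from it by a direction `D`, contradicting the first-order upper bound
along `D`. -/
theorem mem_convexHull_extremeGradients_iff [NeZero m] {S H : Matrix (Fin n) (Fin m) ℝ} :
    H ∈ convexHull ℝ (extremeGradients S) ↔
      ∀ Y, 1 / 2 * opNorm S ^ 2 + inner ℝ H (Y - S) ≤ 1 / 2 * opNorm Y ^ 2 := by
  refine ⟨half_opNorm_sq_add_inner_le_of_mem_convexHull, fun h => ?_⟩
  by_contra hH
  obtain ⟨g, a, hga, haH⟩ := geometric_hahn_banach_closed_point
    (convex_convexHull ℝ (extremeGradients S))
    (isCompact_convexHull_of_finiteDimensional (isCompact_extremeGradients S)).isClosed hH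
  obtain ⟨D, rfl⟩ := (InnerProductSpace.toDual ℝ (Matrix (Fin n) (Fin m) ℝ)).surjective g
  simp only [InnerProductSpace.toDual_apply_apply] at hga haH
  set ε := (inner ℝ D H - a) / (‖D‖ + 1) with hε
  have hε0 : 0 < ε := div_pos (sub_pos.2 haH) (by positivity)
  obtain ⟨δ, hδ, hbound⟩ := exists_maxVector_half_norm_sq_add_le (euclideanCLM S) hε0
  set t := δ / 2 / (‖D‖ + 1) with ht
  have ht0 : 0 < t := by positivity
  have htD : t * ‖D‖ < δ := by
    have : t * (‖D‖ + 1) = δ / 2 := div_mul_cancel₀ _ (by positivity)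
    nlinarith [norm_nonneg D]
  have hn : ‖euclideanCLM (t • D)‖ ≤ t * ‖D‖ := by
    refine (norm_euclideanCLM_le _).trans_eq ?_
    rw [norm_smul, Real.norm_of_nonneg ht0.le]
  obtain ⟨v, hv, hle⟩ := hbound (euclideanCLM (t • D)) (hn.trans_lt htD)
  have h1 := h (S + t • D)
  rw [add_sub_cancel_left, real_inner_smul_right, real_inner_comm, opNorm_eq, opNorm_eq,
    map_add] at h1
  have h2 := hga _ (subset_convexHull ℝ _ ⟨v, hv, rfl⟩)
  rw [real_inner_comm, inner_outer_left] at h2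
  rw [map_smul, smul_apply, real_inner_smul_right, ← map_smul] at hle
  have h3 : ε * ‖euclideanCLM (t • D)‖ ≤ t * (ε * ‖D‖) := by
    nlinarith [mul_le_mul_of_nonneg_left hn hε0.le]
  have h4 : ε * (‖D‖ + 1) = inner ℝ D H - a := div_mul_cancel₀ _ (by positivity)
  have h5 : t * inner ℝ D H ≤ t * (inner ℝ (euclideanCLM S v) (euclideanCLM D v) + ε * ‖D‖) := by
    linarith
  have h6 := le_of_mul_le_mul_left h5 ht0
  linarith

/-! ### Singular values and top singular pairs -/

section SingularValues

variable (S : Matrix (Fin n) (Fin m) ℝ)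

/-- The Gram operator `SᵀS`, in the form used by the definition of singular values. -/
noncomputable def gram : EuclideanSpace ℝ (Fin m) →ₗ[ℝ] EuclideanSpace ℝ (Fin m) :=
  LinearMap.adjoint (Matrix.toEuclideanLin S) ∘ₗ Matrix.toEuclideanLin S

theorem gram_isSymmetric : (gram S).IsSymmetric :=
  (Matrix.toEuclideanLin S).isSymmetric_adjoint_comp_self

theorem gram_apply (x : EuclideanSpace ℝ (Fin m)) :
    gram S x = (euclideanCLM S).adjoint (euclideanCLM S x) := rfl

theorem inner_gram (x y : EuclideanSpace ℝ (Fin m)) :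
    inner ℝ (gram S x) y = inner ℝ (euclideanCLM S x) (euclideanCLM S y) := by
  rw [gram_apply, ContinuousLinearMap.adjoint_inner_left]

theorem eigenvalues_gram (i : Fin m) :
    (gram_isSymmetric S).eigenvalues finrank_euclideanSpace_fin i = sv S i ^ 2 :=
  ((Matrix.toEuclideanLin S).sq_singularValues_fin finrank_euclideanSpace_fin i).symm

theorem sv_nonneg (i : ℕ) : 0 ≤ sv S i := LinearMap.singularValues_nonneg _ i

theorem svMax_nonneg : 0 ≤ svMax S := sv_nonneg S 0

theorem sv_eq_zero_of_le {i : ℕ} (hi : n ≤ i) : sv S i = 0 := by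
  rw [sv, LinearMap.singularValues_eq_zero_iff_le_finrank_range]
  refine le_trans ?_ hi
  simpa using Submodule.finrank_le (LinearMap.range (Matrix.toEuclideanLin S))

theorem svMax_eq_norm [NeZero m] : svMax S = ‖euclideanCLM S‖ := by
  refine le_antisymm ?_ ?_
  · obtain ⟨w, hw⟩ := ((gram_isSymmetric S).hasEigenvalue_eigenvalues finrank_euclideanSpace_fin
      (0 : Fin m)).exists_hasEigenvector
    have h1 : gram S w = sv S 0 ^ 2 • w := by
      have := hw.apply_eq_smul
      rw [eigenvalues_gram] at this
      simpa using this
    have h2 : ‖euclideanCLM S w‖ ^ 2 = (sv S 0 * ‖w‖) ^ 2 := by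
      rw [← real_inner_self_eq_norm_sq, ← inner_gram, h1, real_inner_smul_left,
        real_inner_self_eq_norm_sq, mul_pow]
    have h3 : ‖euclideanCLM S w‖ = sv S 0 * ‖w‖ :=
      (pow_left_inj₀ (norm_nonneg _) (mul_nonneg (sv_nonneg S 0) (norm_nonneg _)) two_ne_zero).1 h2
    have h4 := (euclideanCLM S).le_opNorm w
    rw [h3] at h4
    exact le_of_mul_le_mul_right h4 (norm_pos_iff.2 hw.2)
  · obtain ⟨v, hv⟩ := maxVectors_nonempty (euclideanCLM S)
    have hv0 : v ≠ 0 := norm_ne_zero_iff.1 (by rw [hv.1]; exact one_ne_zero)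
    have hg : gram S v = ‖euclideanCLM S‖ ^ 2 • v := by
      rw [gram_apply]
      exact adjoint_apply_apply_of_mem_maxVectors hv
    have h1 : Module.End.HasEigenvalue (gram S) (‖euclideanCLM S‖ ^ 2) :=
      Module.End.hasEigenvalue_of_hasEigenvector
        (Module.End.hasEigenvector_iff.2 ⟨Module.End.mem_eigenspace_iff.2 hg, hv0⟩)
    obtain ⟨i, hi⟩ := (gram_isSymmetric S).exists_eigenvalues_eq finrank_euclideanSpace_fin h1
    replace hi : sv S i ^ 2 = ‖euclideanCLM S‖ ^ 2 := by
      rw [← eigenvalues_gram]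
      exact hi
    have h2 : sv S i = ‖euclideanCLM S‖ :=
      (pow_left_inj₀ (sv_nonneg S i) (norm_nonneg _) two_ne_zero).1 hi
    rw [← h2]
    exact (Matrix.toEuclideanLin S).singularValues_antitone (Nat.zero_le _)

variable {S}

theorem gram_apply_of_mem_maxVectors [NeZero m] {v : EuclideanSpace ℝ (Fin m)}
    (hv : v ∈ maxVectors (euclideanCLM S)) : gram S v = svMax S ^ 2 • v := by
  rw [gram_apply, svMax_eq_norm]
  exact adjoint_apply_apply_of_mem_maxVectors hv

theorem eq_zero_of_svMax_eq_zero [NeZero m] (h : svMax S = 0) : S = 0 := by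
  rw [svMax_eq_norm, norm_eq_zero] at h
  exact (Matrix.toEuclideanLin.trans (LinearMap.toContinuousLinearMap (𝕜 := ℝ)
    (E := EuclideanSpace ℝ (Fin m)) (F' := EuclideanSpace ℝ (Fin n)))).injective
    (h.trans (map_zero euclideanCLM).symm)

theorem norm_toLp_eq_one_iff {k : ℕ} {x : Fin k → ℝ} : ‖WithLp.toLp 2 x‖ = 1 ↔ x ⬝ᵥ x = 1 := by
  have h : ‖WithLp.toLp 2 x‖ ^ 2 = x ⬝ᵥ x := by
    rw [EuclideanSpace.real_norm_sq_eq, dotProduct]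
    simp [sq]
  rw [← h, pow_eq_one_iff_of_nonneg (norm_nonneg _) two_ne_zero]

theorem topPairs_eq_extremeGradients [NeZero n] [NeZero m] :
    {A : Matrix (Fin n) (Fin m) ℝ | ∃ (u : Fin n → ℝ) (v : Fin m → ℝ),
      IsTopPair S u v ∧ A = svMax S • Matrix.vecMulVec u v} = extremeGradients S := by
  ext A
  constructor
  · rintro ⟨u, v, ⟨hu, hv, hSv, -⟩, rfl⟩
    have hSv' : euclideanCLM S (WithLp.toLp 2 v) = svMax S • WithLp.toLp 2 u :=
      congrArg (WithLp.toLp 2) hSv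
    refine ⟨WithLp.toLp 2 v, ⟨norm_toLp_eq_one_iff.2 hv, ?_⟩, ?_⟩
    · rw [hSv', norm_smul, norm_toLp_eq_one_iff.2 hu, mul_one,
        Real.norm_of_nonneg (svMax_nonneg S), svMax_eq_norm]
    · simp only [hSv', outer, WithLp.ofLp_smul, Matrix.smul_vecMulVec]
  · rintro ⟨v, hv, rfl⟩
    have hv1 : v.ofLp ⬝ᵥ v.ofLp = 1 := norm_toLp_eq_one_iff.1 hv.1
    rcases eq_or_ne (svMax S) 0 with h0 | h0
    · -- for `S = 0` every pair of unit vectors is a top pair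
      obtain rfl := eq_zero_of_svMax_eq_zero h0
      refine ⟨Pi.single 0 1, v.ofLp, ⟨by simp, hv1, by simp [h0],
        by rw [h0, zero_smul, Matrix.transpose_zero, Matrix.zero_mulVec]⟩, ?_⟩
      simp [h0, outer]
    · refine ⟨(svMax S)⁻¹ • S.mulVec v.ofLp, v.ofLp, ⟨?_, hv1, ?_, ?_⟩, ?_⟩
      · rw [← norm_toLp_eq_one_iff, WithLp.toLp_smul, ← euclideanCLM_apply, norm_smul, hv.2,
          ← svMax_eq_norm, norm_inv, Real.norm_of_nonneg (svMax_nonneg S), inv_mul_cancel₀ h0]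
      · rw [smul_inv_smul₀ h0]
      · have h1 := gram_apply_of_mem_maxVectors hv
        rw [gram_apply, adjoint_euclideanCLM, euclideanCLM_apply, euclideanCLM_apply] at h1
        have h2 : S.transpose.mulVec (S.mulVec v.ofLp) = svMax S ^ 2 • v.ofLp :=
          congrArg WithLp.ofLp h1
        rw [Matrix.mulVec_smul, h2, smul_smul, sq, inv_mul_cancel_left₀ h0]
      · rw [Matrix.smul_vecMulVec, smul_inv_smul₀ h0]
        rfl

end SingularValues

end MatReg

namespace MatReg

variable {n m : ℕ} {S : Matrix (Fin n) (Fin m) ℝ}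

/-! ### Singular value decompositions -/

section OfSVD

variable {U : Matrix (Fin n) (Fin n) ℝ} {V : Matrix (Fin m) (Fin m) ℝ}

theorem norm_col_of_mem_orthogonalGroup {k : ℕ} {W : Matrix (Fin k) (Fin k) ℝ}
    (hW : W ∈ Matrix.orthogonalGroup (Fin k) ℝ) (j : Fin k) : ‖WithLp.toLp 2 (W.col j)‖ = 1 := by
  rw [norm_toLp_eq_one_iff]
  have h := congrFun (congrFun ((Matrix.mem_orthogonalGroup_iff' _ _).1 hW) j) j
  rw [Matrix.one_apply_eq] at h
  exact h

theorem IsSVD.euclideanCLM_col (h : IsSVD S U V) (i : Fin (min n m)) :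
    euclideanCLM S (WithLp.toLp 2 (V.col (Fin.castLE (Nat.min_le_right n m) i))) =
      sv S i • WithLp.toLp 2 (U.col (Fin.castLE (Nat.min_le_left n m) i)) := by
  have h1 : S * V = U * diagSv S := by
    conv_lhs => rw [h.decomp]
    rw [Matrix.mul_assoc, (Matrix.mem_orthogonalGroup_iff' _ _).1 h.right_orthogonal,
      Matrix.mul_one]
  ext k
  have h2 := congrFun (congrFun h1 k) (Fin.castLE (Nat.min_le_right n m) i)
  have h3 : (U * diagSv S) k (Fin.castLE (Nat.min_le_right n m) i) =
      U k (Fin.castLE (Nat.min_le_left n m) i) * sv S i := by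
    rw [Matrix.mul_apply, Finset.sum_eq_single (Fin.castLE (Nat.min_le_left n m) i)]
    · simp [diagSv]
    · intro l _ hl
      have : (l : ℕ) ≠ i := fun e => hl (Fin.ext e)
      simp [diagSv, this]
    · simp
  rw [h3, mul_comm] at h2
  exact h2

theorem IsSVD.outer_col (h : IsSVD S U V) (i : Fin (min n m)) :
    outer (euclideanCLM S (WithLp.toLp 2 (V.col (Fin.castLE (Nat.min_le_right n m) i))))
      (WithLp.toLp 2 (V.col (Fin.castLE (Nat.min_le_right n m) i))) =
      sv S i • outerCol U V i := by
  rw [h.euclideanCLM_col, outer, WithLp.ofLp_smul, Matrix.smul_vecMulVec]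
  rfl

theorem IsSVD.col_mem_maxVectors [NeZero m] (h : IsSVD S U V) {i : Fin (min n m)}
    (hi : sv S i = svMax S) :
    WithLp.toLp 2 (V.col (Fin.castLE (Nat.min_le_right n m) i)) ∈ maxVectors (euclideanCLM S) := by
  refine ⟨norm_col_of_mem_orthogonalGroup h.right_orthogonal _, ?_⟩
  rw [h.euclideanCLM_col, hi, norm_smul, norm_col_of_mem_orthogonalGroup h.left_orthogonal,
    mul_one, Real.norm_of_nonneg (svMax_nonneg S), svMax_eq_norm]

theorem IsSVD.topHull_subset [NeZero m] (h : IsSVD S U V) :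
    topHull S U V ⊆ convexHull ℝ (extremeGradients S) := by
  refine convexHull_mono ?_
  rintro _ ⟨i, hi, rfl⟩
  exact ⟨_, h.col_mem_maxVectors hi, h.outer_col i⟩

end OfSVD

/-- An orthonormal basis of eigenvectors of `SᵀS`, ordered as the singular values, supplies the
right factor of an SVD. The columns of the left factor are `S wᵢ / σᵢ` where `σᵢ > 0`, completed
to an orthonormal basis. -/
theorem exists_isSVD_of_orthonormal {w : Fin m → EuclideanSpace ℝ (Fin m)}
    (hw : Orthonormal ℝ w) (heig : ∀ j, gram S (w j) = sv S j ^ 2 • w j) :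
    ∃ U, IsSVD S U (Matrix.of fun i j => w j i) := by
  have hinner (i j : Fin m) : inner ℝ (euclideanCLM S (w i)) (euclideanCLM S (w j)) =
      if i = j then sv S i ^ 2 else 0 := by
    rw [← inner_gram, heig, real_inner_smul_left, orthonormal_iff_ite.1 hw]
    simp
  let s : Set (Fin n) := {i | ∃ hi : (i : ℕ) < m, 0 < sv S i}
  let u : Fin n → EuclideanSpace ℝ (Fin n) := fun i =>
    if hi : (i : ℕ) < m then (sv S i)⁻¹ • euclideanCLM S (w ⟨i, hi⟩) else 0
  have hu : Orthonormal ℝ (s.domRestrict u) := by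
    rw [orthonormal_iff_ite]
    rintro ⟨i, hi, hi0⟩ ⟨j, hj, hj0⟩
    simp only [Set.domRestrict_apply, u, hi, hj, dif_pos, real_inner_smul_left,
      real_inner_smul_right, hinner, Subtype.mk.injEq, Fin.ext_iff]
    split_ifs with hij
    · rw [← hij]
      field_simp
    · simp
  obtain ⟨b, hb⟩ := hu.exists_orthonormalBasis_extension_of_card_eq (by simp)
  have hcol (j : Fin m) (hj : (j : ℕ) < n) : euclideanCLM S (w j) = sv S j • b ⟨j, hj⟩ := by
    rcases (sv_nonneg S j).eq_or_lt with h0 | h0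
    · have h1 := hinner j j
      rw [if_pos rfl, real_inner_self_eq_norm_sq, ← h0] at h1
      rw [← h0, zero_smul]
      simpa using h1
    · rw [hb ⟨j, hj⟩ ⟨j.2, h0⟩]
      simp only [u, j.2, dif_pos]
      rw [smul_inv_smul₀ h0.ne']
  have hcol0 (j : Fin m) (hj : n ≤ (j : ℕ)) : euclideanCLM S (w j) = 0 := by
    have h1 := hinner j j
    rw [if_pos rfl, real_inner_self_eq_norm_sq, sv_eq_zero_of_le S hj] at h1
    simpa using h1
  have horth {k : ℕ} {x : Fin k → EuclideanSpace ℝ (Fin k)} (hx : Orthonormal ℝ x) :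
      (Matrix.of fun i j => x j i) ∈ Matrix.orthogonalGroup (Fin k) ℝ := by
    rw [Matrix.mem_orthogonalGroup_iff']
    ext i j
    rw [Matrix.one_apply, ← orthonormal_iff_ite.1 hx i j]
    simp [Matrix.mul_apply, PiLp.inner_apply, mul_comm]
  refine ⟨Matrix.of fun i j => b j i, horth b.orthonormal, horth hw, ?_⟩
  have hSV : S * (Matrix.of fun i j => w j i) = (Matrix.of fun i j => b j i) * diagSv S := by
    ext k j
    have h1 : (S * (Matrix.of fun i j => w j i)) k j = euclideanCLM S (w j) k := rfl
    rw [h1, Matrix.mul_apply]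
    by_cases hj : (j : ℕ) < n
    · rw [hcol j hj, Finset.sum_eq_single ⟨j, hj⟩]
      · simp [diagSv, mul_comm]
      · intro l _ hl
        have : (l : ℕ) ≠ j := fun e => hl (Fin.ext e)
        simp [diagSv, this]
      · simp
    · rw [hcol0 j (not_lt.1 hj), Finset.sum_eq_zero]
      · simp
      · intro l _
        have : (l : ℕ) ≠ j := by omega
        simp [diagSv, this]
  rw [← hSV, Matrix.mul_assoc, (Matrix.mem_orthogonalGroup_iff _ _).1 (horth hw), Matrix.mul_one]

theorem exists_orthonormal_gram_eigenvectors (S : Matrix (Fin n) (Fin m) ℝ) :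
    ∃ w : Fin m → EuclideanSpace ℝ (Fin m), Orthonormal ℝ w ∧
      ∀ j, gram S (w j) = sv S j ^ 2 • w j := by
  refine ⟨(gram_isSymmetric S).eigenvectorBasis finrank_euclideanSpace_fin,
    OrthonormalBasis.orthonormal _, fun j => ?_⟩
  rw [LinearMap.IsSymmetric.apply_eigenvectorBasis, eigenvalues_gram]
  rfl

/-- The eigenspace of `SᵀS` for its largest eigenvalue `σ_max²`. -/
noncomputable abbrev topSpace (S : Matrix (Fin n) (Fin m) ℝ) :
    Submodule ℝ (EuclideanSpace ℝ (Fin m)) :=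
  Module.End.eigenspace (gram S) (svMax S ^ 2)

theorem card_sv_eq_svMax (S : Matrix (Fin n) (Fin m) ℝ) :
    Fintype.card {i : Fin m // sv S i = svMax S} = Module.finrank ℝ (topSpace S) := by
  have h := (gram_isSymmetric S).card_filter_eigenvalues_eq finrank_euclideanSpace_fin
    (svMax S ^ 2)
  rw [← h, Fintype.card_subtype]
  congr 1
  ext i
  simp only [Finset.mem_filter, Finset.mem_univ, true_and, eigenvalues_gram]
  exact (pow_left_inj₀ (sv_nonneg S i) (svMax_nonneg S) two_ne_zero).symm

/-- Any orthonormal basis of the top eigenspace occurs among the right singular vectors of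
some SVD. -/
theorem exists_isSVD_of_topSpace_basis
    (b : OrthonormalBasis (Fin (Module.finrank ℝ (topSpace S))) ℝ (topSpace S)) :
    ∃ U V, IsSVD S U V ∧ ∀ k, ∃ j : Fin m, sv S j = svMax S ∧
      WithLp.toLp 2 (V.col j) = (b k : EuclideanSpace ℝ (Fin m)) := by
  obtain ⟨w, hw, heig⟩ := exists_orthonormal_gram_eigenvectors S
  let e := Fintype.equivFinOfCardEq (card_sv_eq_svMax S)
  let w' : Fin m → EuclideanSpace ℝ (Fin m) := fun j =>
    if h : sv S j = svMax S then (b (e ⟨j, h⟩) : EuclideanSpace ℝ (Fin m)) else w j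
  have heig' (j : Fin m) : gram S (w' j) = sv S j ^ 2 • w' j := by
    by_cases h : sv S j = svMax S
    · simp only [w', h, dif_pos]
      exact Module.End.mem_eigenspace_iff.1 (b (e ⟨j, h⟩)).2
    · simp only [w', h, dif_neg, not_false_iff, heig]
  have hw' : Orthonormal ℝ w' := by
    rw [orthonormal_iff_ite]
    intro i j
    by_cases hij : sv S i = sv S j
    · by_cases hi : sv S i = svMax S
      · have hj : sv S j = svMax S := hij ▸ hi
        simp only [w', hi, hj, dif_pos]
        rw [← Submodule.coe_inner, orthonormal_iff_ite.1 b.orthonormal]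
        simp
      · have hj : sv S j ≠ svMax S := hij ▸ hi
        simp only [w', hi, hj, dif_neg, not_false_iff]
        exact orthonormal_iff_ite.1 hw i j
    · -- eigenvectors of `SᵀS` for different eigenvalues are orthogonal
      have hne : i ≠ j := fun h => hij (by rw [h])
      have h1 := gram_isSymmetric S (w' i) (w' j)
      rw [heig', heig', real_inner_smul_left, real_inner_smul_right, ← sub_eq_zero,
        ← sub_mul] at h1
      rw [if_neg hne]
      refine (mul_eq_zero.1 h1).resolve_left fun h2 => hij ?_
      exact (pow_left_inj₀ (sv_nonneg S i) (sv_nonneg S j) two_ne_zero).1 (sub_eq_zero.1 h2)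
  obtain ⟨U, hU⟩ := exists_isSVD_of_orthonormal hw' heig'
  refine ⟨U, _, hU, fun k => ⟨(e.symm k).1, (e.symm k).2, ?_⟩⟩
  change w' (e.symm k).1 = _
  simp only [w', (e.symm k).2, dif_pos, Subtype.coe_eta, Equiv.apply_symm_apply]

/-! ### Convex combinations of extreme gradients -/

/-- The symmetric operator `M x = ∑ cₖ ⟪vₖ, x⟫ vₖ` is diagonal in some orthonormal basis `b`; the
sums below are its off-diagonal matrix entries `⟪bᵢ, M bⱼ⟫`. -/
theorem exists_orthonormalBasis_diagonalizing {E ι : Type*} [NormedAddCommGroup E]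
    [InnerProductSpace ℝ E] [FiniteDimensional ℝ E] [Fintype ι] (c : ι → ℝ) (v : ι → E) :
    ∃ b : OrthonormalBasis (Fin (Module.finrank ℝ E)) ℝ E, ∀ i j, i ≠ j →
      ∑ k, c k * (inner ℝ (b i) (v k) * inner ℝ (b j) (v k)) = 0 := by
  let M : E →ₗ[ℝ] E := ∑ k, c k • ((innerSL ℝ (v k)).smulRight (v k) : E →L[ℝ] E).toLinearMap
  have hM (x : E) : M x = ∑ k, c k • (inner ℝ (v k) x • v k) := by
    simp [M, LinearMap.sum_apply]
  have hsymm : M.IsSymmetric := fun x y => by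
    simp only [hM, sum_inner, inner_sum, real_inner_smul_left, real_inner_smul_right]
    exact Finset.sum_congr rfl fun k _ => by rw [real_inner_comm x]; ring
  refine ⟨hsymm.eigenvectorBasis rfl, fun i j hij => ?_⟩
  have h1 : inner ℝ (hsymm.eigenvectorBasis rfl i) (M (hsymm.eigenvectorBasis rfl j)) = 0 := by
    rw [hsymm.apply_eigenvectorBasis, inner_smul_right, OrthonormalBasis.inner_eq_zero _ hij,
      mul_zero]
  rw [← h1, hM]
  simp only [inner_sum, real_inner_smul_right]
  exact Finset.sum_congr rfl fun k _ => by
    rw [real_inner_comm (v k) (hsymm.eigenvectorBasis rfl j)]; ring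

theorem outer_eq_zero_of_left {y : EuclideanSpace ℝ (Fin m)} :
    outer (0 : EuclideanSpace ℝ (Fin n)) y = 0 := by
  simp [outer]

/-- `(x, y) ↦ x yᵀ` as a bilinear map. -/
noncomputable def outerBilin : EuclideanSpace ℝ (Fin n) →ₗ[ℝ] EuclideanSpace ℝ (Fin m) →ₗ[ℝ]
    Matrix (Fin n) (Fin m) ℝ :=
  LinearMap.mk₂ ℝ outer (fun _ _ _ => Matrix.add_vecMulVec _ _ _)
    (fun _ _ _ => Matrix.smul_vecMulVec _ _ _) (fun _ _ _ => Matrix.vecMulVec_add _ _ _)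
    (fun _ _ _ => Matrix.vecMulVec_smul _ _ _)

/-- Every convex combination of extreme gradients is one of those coming from a single SVD: it has
the form `S M` with `M = ∑ cₖ vₖ vₖᵀ` on the top eigenspace, and one takes the SVD whose top right
singular vectors diagonalize `M`. -/
theorem exists_isSVD_mem_topHull [NeZero n] [NeZero m] {A : Matrix (Fin n) (Fin m) ℝ}
    (hA : A ∈ convexHull ℝ (extremeGradients S)) : ∃ U V, IsSVD S U V ∧ A ∈ topHull S U V := by
  rcases eq_or_ne (svMax S) 0 with h0 | h0
  · obtain rfl := eq_zero_of_svMax_eq_zero h0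
    obtain ⟨w, hw, heig⟩ := exists_orthonormal_gram_eigenvectors (0 : Matrix (Fin n) (Fin m) ℝ)
    obtain ⟨U, hU⟩ := exists_isSVD_of_orthonormal hw heig
    have hA0 : A = 0 := by
      have : extremeGradients (0 : Matrix (Fin n) (Fin m) ℝ) ⊆ {0} := by
        rintro _ ⟨v, -, rfl⟩
        simp [outer]
      simpa using convexHull_min this (convex_singleton 0) hA
    refine ⟨U, _, hU, subset_convexHull ℝ _
      ⟨⟨0, lt_min (NeZero.pos n) (NeZero.pos m)⟩, rfl, ?_⟩⟩
    rw [hA0]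
    change 0 = svMax 0 • _
    rw [h0, zero_smul]
  obtain ⟨ι, _, c, z, hc, hc1, hz, rfl⟩ := mem_convexHull_iff_exists_fintype.1 hA
  choose v hv hvz using hz
  have hvtop (k : ι) : v k ∈ topSpace S :=
    Module.End.mem_eigenspace_iff.2 (gram_apply_of_mem_maxVectors (hv k))
  let v' : ι → topSpace S := fun k => ⟨v k, hvtop k⟩
  obtain ⟨b, hb⟩ := exists_orthonormalBasis_diagonalizing c v'
  obtain ⟨U, V, hUV, hcol⟩ := exists_isSVD_of_topSpace_basis b
  refine ⟨U, V, hUV, ?_⟩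
  let μ : Fin (Module.finrank ℝ (topSpace S)) → ℝ :=
    fun i => ∑ k, c k * (inner ℝ (b i) (v' k) * inner ℝ (b i) (v' k))
  have hexp (k : ι) : v k = ∑ i, inner ℝ (b i) (v' k) • (b i : EuclideanSpace ℝ (Fin m)) := by
    have := congrArg (Submodule.subtype _) (b.sum_repr' (v' k))
    rw [map_sum] at this
    simpa using this.symm
  have hsum : ∑ k, c k • z k =
      ∑ i, μ i • outer (euclideanCLM S (b i : EuclideanSpace ℝ (Fin m))) (b i) := by
    let B : topSpace S → topSpace S → Matrix (Fin n) (Fin m) ℝ := fun x y =>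
      outer (euclideanCLM S (x : EuclideanSpace ℝ (Fin m))) y
    have hzk (k : ι) : z k =
        ∑ i, ∑ j, (inner ℝ (b i) (v' k) * inner ℝ (b j) (v' k)) • B (b i) (b j) := by
      have h1 : z k = outerBilin (euclideanCLM S (v k)) (v k) := (hvz k).symm
      rw [h1]
      conv_lhs => rw [hexp k]
      simp only [map_sum, map_smul, LinearMap.sum_apply, LinearMap.smul_apply, Finset.smul_sum,
        smul_smul]
      rw [Finset.sum_comm]
      refine Finset.sum_congr rfl fun i _ => Finset.sum_congr rfl fun j _ => ?_
      rw [mul_comm]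
      rfl
    calc ∑ k, c k • z k
        = ∑ i, ∑ j, (∑ k, c k * (inner ℝ (b i) (v' k) * inner ℝ (b j) (v' k))) •
            B (b i) (b j) := by
          simp only [hzk, Finset.smul_sum, Finset.sum_smul, smul_smul]
          rw [Finset.sum_comm]
          exact Finset.sum_congr rfl fun i _ => Finset.sum_comm
      _ = ∑ i, μ i • B (b i) (b i) := by
          refine Finset.sum_congr rfl fun i _ => ?_
          refine Finset.sum_eq_single i (fun j _ hji => ?_) (by simp)
          rw [hb i j hji.symm, zero_smul]
  rw [hsum]
  refine (convex_convexHull ℝ _).sum_mem (fun i _ => ?_) ?_ fun i _ => ?_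
  · exact Finset.sum_nonneg fun k _ => mul_nonneg (hc k) (mul_self_nonneg _)
  · -- the weights sum to `∑ cₖ ‖vₖ‖² = 1` by Parseval
    rw [Finset.sum_comm, ← hc1]
    refine Finset.sum_congr rfl fun k _ => ?_
    have h1 : ∑ i, inner ℝ (b i) (v' k) * inner ℝ (b i) (v' k) = 1 := by
      have := b.sum_sq_norm_inner_right (v' k)
      have hvk : ‖v' k‖ = 1 := (hv k).1
      rw [hvk] at this
      simpa [sq] using this
    rw [← Finset.mul_sum, h1, mul_one]
  · obtain ⟨j, hj, hjb⟩ := hcol i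
    have hjn : (j : ℕ) < n := by
      by_contra hjn
      exact h0 (by rw [← hj, sv_eq_zero_of_le S (not_lt.1 hjn)])
    refine subset_convexHull ℝ _ ⟨⟨j, lt_min hjn j.2⟩, hj, ?_⟩
    rw [← hUV.outer_col]
    change _ = outer (euclideanCLM S (WithLp.toLp 2 (V.col j))) (WithLp.toLp 2 (V.col j))
    rw [hjb]

/-- If the top singular value is simple, the top eigenspace of `SᵀS` is a line (or `S = 0`), so
every top right singular vector equals that of the given SVD up to sign. -/
theorem IsSVD.outer_eq_of_simpleTop [NeZero n] [NeZero m] {U : Matrix (Fin n) (Fin n) ℝ}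
    {V : Matrix (Fin m) (Fin m) ℝ} (h : IsSVD S U V) (hsimple : SimpleTop S)
    {v : EuclideanSpace ℝ (Fin m)} (hv : v ∈ maxVectors (euclideanCLM S)) :
    outer (euclideanCLM S v) v =
      svMax S • outerCol U V ⟨0, lt_min (NeZero.pos n) (NeZero.pos m)⟩ := by
  rcases eq_or_ne (svMax S) 0 with h0 | h0
  · rw [h0, zero_smul, eq_zero_of_svMax_eq_zero h0, map_zero, zero_apply, outer_eq_zero_of_left]
  have hpos : 0 < svMax S := (svMax_nonneg S).lt_of_ne' h0
  let i₀ : Fin (min n m) := ⟨0, lt_min (NeZero.pos n) (NeZero.pos m)⟩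
  let v₀ := WithLp.toLp 2 (V.col (Fin.castLE (Nat.min_le_right n m) i₀))
  have hv₀ : v₀ ∈ maxVectors (euclideanCLM S) := h.col_mem_maxVectors (i := i₀) rfl
  have hcard : Module.finrank ℝ (topSpace S) = 1 := by
    rw [← card_sv_eq_svMax, Fintype.card_eq_one_iff]
    refine ⟨⟨0, rfl⟩, fun ⟨i, hi⟩ => Subtype.ext (Fin.ext ?_)⟩
    by_contra hi0
    have hi0' : 0 < (i : ℕ) := Nat.pos_of_ne_zero hi0
    by_cases hin : (i : ℕ) < n
    · exact (hsimple i hi0' (lt_min hin i.2)).ne hi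
    · rw [sv_eq_zero_of_le S (not_lt.1 hin)] at hi
      exact h0 hi.symm
  have hmem {x : EuclideanSpace ℝ (Fin m)} (hx : x ∈ maxVectors (euclideanCLM S)) :
      x ∈ topSpace S := Module.End.mem_eigenspace_iff.2 (gram_apply_of_mem_maxVectors hx)
  have hne : (⟨v₀, hmem hv₀⟩ : topSpace S) ≠ 0 := fun h1 => by
    have h2 : v₀ = 0 := congrArg Subtype.val h1
    have h3 := hv₀.1
    rw [h2, norm_zero] at h3
    exact zero_ne_one h3
  obtain ⟨a, ha⟩ := (finrank_eq_one_iff_of_nonzero' _ hne).1 hcard ⟨v, hmem hv⟩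
  have ha : a • v₀ = v := congrArg Subtype.val ha
  have ha1 : a * a = 1 := by
    have h1 := hv.1
    rw [← ha, norm_smul, hv₀.1, mul_one, Real.norm_eq_abs] at h1
    rw [← abs_mul_abs_self, h1, one_mul]
  have h2 : outer (euclideanCLM S v) v = (a * a) • outer (euclideanCLM S v₀) v₀ := by
    change outerBilin _ _ = _ • outerBilin _ _
    rw [← ha]
    simp only [map_smul, LinearMap.smul_apply, smul_smul]
  rw [h2, ha1, one_smul]
  exact h.outer_col i₀

end MatReg

namespace MatReg

variable {n m : ℕ} {S : Matrix (Fin n) (Fin m) ℝ}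

/-! ### The regularizer -/

theorem reg_eq : (reg : Matrix (Fin n) (Fin m) ℝ → ℝ) =
    fun S => 1 / 2 * opNorm S ^ 2 - 1 / (2 * ((min n m : ℕ) : ℝ)) * ‖S‖ ^ 2 := rfl

theorem two_mul_regWeight :
    2 * (1 / (2 * ((min n m : ℕ) : ℝ))) = 1 / ((min n m : ℕ) : ℝ) := by
  rw [one_div, mul_inv, mul_inv_cancel_left₀ two_ne_zero, one_div]

theorem limitingSubdifferential_reg [NeZero m] :
    limitingSubdifferential (reg : Matrix (Fin n) (Fin m) ℝ → ℝ) S =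
      {G | ∃ H ∈ convexHull ℝ (extremeGradients S),
        G = H - (1 / ((min n m : ℕ) : ℝ)) • S} := by
  ext G
  rw [reg_eq, mem_limitingSubdifferential_sub_norm_sq_iff convexOn_half_opNorm_sq
    (continuous_const.mul (continuous_opNorm.pow 2)) (by positivity),
    ← mem_convexHull_extremeGradients_iff, two_mul_regWeight]
  constructor
  · exact fun h => ⟨_, h, (add_sub_cancel_right _ _).symm⟩
  · rintro ⟨H, hH, rfl⟩
    rwa [sub_add_cancel]

/-- If all extreme gradients coincide, the convex lower bound and the first-order upper bound
on `½ ‖·‖₂²` agree. -/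
theorem hasGradientAt_half_opNorm_sq [NeZero m] {A : Matrix (Fin n) (Fin m) ℝ}
    (hA : ∀ v ∈ maxVectors (euclideanCLM S), outer (euclideanCLM S v) v = A) :
    HasGradientAt (fun Y : Matrix (Fin n) (Fin m) ℝ => 1 / 2 * opNorm Y ^ 2) A S := by
  rw [hasGradientAt_iff_isLittleO, Asymptotics.isLittleO_iff]
  intro ε hε
  obtain ⟨δ, hδ, hbound⟩ := exists_maxVector_half_norm_sq_add_le (euclideanCLM S) hε
  filter_upwards [Metric.ball_mem_nhds S hδ] with Y hY
  have hY : ‖Y - S‖ < δ := by rwa [← dist_eq_norm]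
  have hle := norm_euclideanCLM_le (Y - S)
  obtain ⟨v, hv, hupper⟩ := hbound (euclideanCLM (Y - S)) (hle.trans_lt hY)
  rw [← inner_outer_left, hA v hv, ← map_add, add_sub_cancel, ← opNorm_eq, ← opNorm_eq] at hupper
  have hlower := half_opNorm_sq_add_inner_le_of_mem_extremeGradients ⟨v, hv, hA v hv⟩ Y
  rw [Real.norm_of_nonneg (by linarith)]
  linarith [mul_le_mul_of_nonneg_left hle hε.le]

theorem hasGradientAt_reg [NeZero m] {A : Matrix (Fin n) (Fin m) ℝ}
    (hA : ∀ v ∈ maxVectors (euclideanCLM S), outer (euclideanCLM S v) v = A) :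
    HasGradientAt (reg : Matrix (Fin n) (Fin m) ℝ → ℝ)
      (A - (1 / ((min n m : ℕ) : ℝ)) • S) S := by
  have h1 := (hasGradientAt_half_opNorm_sq hA).hasFDerivAt
  have h2 := ((hasStrictFDerivAt_norm_sq S).hasFDerivAt).const_mul
    (1 / (2 * ((min n m : ℕ) : ℝ)))
  rw [hasGradientAt_iff_hasFDerivAt, reg_eq]
  refine (h1.sub h2).congr_fderiv ?_
  ext Y
  rw [← two_mul_regWeight]
  simp only [sub_apply, smul_apply, InnerProductSpace.toDual_apply_apply, innerSL_apply_apply,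
    inner_sub_left, real_inner_smul_left, smul_eq_mul, nsmul_eq_mul]
  push_cast
  ring

end MatReg

theorem theorem3 (n m : ℕ) (hn : 0 < n) (hm : 0 < m) (S : Matrix (Fin n) (Fin m) ℝ) :
    (MatReg.SimpleTop S →
      ∀ (U : Matrix (Fin n) (Fin n) ℝ) (V : Matrix (Fin m) (Fin m) ℝ), MatReg.IsSVD S U V →
        HasGradientAt (MatReg.reg : Matrix (Fin n) (Fin m) ℝ → ℝ)
          (MatReg.svMax S • MatReg.outerCol U V ⟨0, lt_min hn hm⟩
            - (1 / ((min n m : ℕ) : ℝ)) • S) S) ∧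
    (¬ MatReg.SimpleTop S →
      MatReg.limitingSubdifferential (MatReg.reg : Matrix (Fin n) (Fin m) ℝ → ℝ) S =
          {G | ∃ (U : Matrix (Fin n) (Fin n) ℝ) (V : Matrix (Fin m) (Fin m) ℝ),
            MatReg.IsSVD S U V ∧
            ∃ H ∈ MatReg.topHull S U V, G = H - (1 / ((min n m : ℕ) : ℝ)) • S} ∧
      MatReg.limitingSubdifferential (MatReg.reg : Matrix (Fin n) (Fin m) ℝ → ℝ) S =
          {G | ∃ H ∈ convexHull ℝ
              {A : Matrix (Fin n) (Fin m) ℝ | ∃ (u : Fin n → ℝ) (v : Fin m → ℝ),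
                MatReg.IsTopPair S u v ∧ A = MatReg.svMax S • Matrix.vecMulVec u v},
            G = H - (1 / ((min n m : ℕ) : ℝ)) • S}) := by
  have : NeZero n := ⟨hn.ne'⟩
  have : NeZero m := ⟨hm.ne'⟩
  refine ⟨fun hsimple U V hUV => MatReg.hasGradientAt_reg fun v hv =>
    hUV.outer_eq_of_simpleTop hsimple hv, fun _ => ⟨?_, ?_⟩⟩
  · rw [MatReg.limitingSubdifferential_reg]
    ext G
    constructor
    · rintro ⟨H, hH, rfl⟩
      obtain ⟨U, V, hUV, hmem⟩ := MatReg.exists_isSVD_mem_topHull hH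
      exact ⟨U, V, hUV, H, hmem, rfl⟩
    · rintro ⟨U, V, hUV, H, hH, rfl⟩
      exact ⟨H, hUV.topHull_subset hH, rfl⟩
  · rw [MatReg.limitingSubdifferential_reg, MatReg.topPairs_eq_extremeGradients]
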